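/- A digraph is strong if for any two distinct vertices $u,v$ it contains a directed path from $u$ to $v$. A bipartite tournament is a loopless digraph without 2-cycles whose underlying undirected graph is a complete bipartite graph $K_{r,s}$ for some $r,s\ge 1$. Let $C_3$ be the directed 3-cycle, and let $T_5$ be the tournament obtained from a 3-cycle $abca$ by adding two new vertices $d,e$ and the arcs $de,ad,bd,cd,ea,eb,ec$. Theorem. Every finite strong tournament with at least two vertices that is not isomorphic to $C_3$ or to $T_5$ contains a spanning subdigraph that is a strong bipartite tournament. -/

import Mathlib

namespace Digraph

variable {V : Type*}

/-- A tournament: a digraph without loops in which any two distinct vertices are joined by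
exactly one arc. -/
def IsTournament (D : Digraph V) : Prop :=
  (∀ v, ¬ D.Adj v v) ∧ ∀ u v, u ≠ v → Xor (D.Adj u v) (D.Adj v u)

/-- A digraph is strong if every vertex can be reached from every other one by a directed path
(equivalently by a directed walk). -/
def IsStrong (D : Digraph V) : Prop :=
  ∀ u v, Relation.ReflTransGen D.Adj u v

/-- A loopless digraph is semicomplete bipartite if its underlying graph, in which `u` and `v`
are adjacent when there is an arc between them in some direction, is a complete bipartite graph
`K_{r,s}` with `r, s ≥ 1`. -/
def IsSemicompleteBipartite (D : Digraph V) : Prop :=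
  (∀ v, ¬ D.Adj v v) ∧
    ∃ r s : ℕ, 1 ≤ r ∧ 1 ≤ s ∧
      Nonempty (D.toSimpleGraphInclusive ≃g _root_.completeBipartiteGraph (Fin r) (Fin s))

/-- A bipartite tournament: a semicomplete bipartite digraph with no 2-cycles. -/
def IsBipartiteTournament (D : Digraph V) : Prop :=
  D.IsSemicompleteBipartite ∧ ∀ u v, D.Adj u v → ¬ D.Adj v u

/-- Two digraphs are isomorphic. -/
def IsIsomorphic {W : Type*} (D : Digraph V) (D' : Digraph W) : Prop :=
  Nonempty (D.Adj ≃r D'.Adj)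

/-- The directed 3-cycle `0 → 1 → 2 → 0`. -/
def cycleThree : Digraph (Fin 3) where
  Adj u v := (u, v) ∈ ({(0, 1), (1, 2), (2, 0)} : Set (Fin 3 × Fin 3))

/-- The tournament `T_5` on the vertices `a, b, c, d, e = 0, 1, 2, 3, 4`: it consists of the
3-cycle `abca` and the arcs `de, ad, bd, cd, ea, eb, ec`. -/
def tournamentFive : Digraph (Fin 5) where
  Adj u v := (u, v) ∈ ({(0, 1), (1, 2), (2, 0), (3, 4), (0, 3), (1, 3), (2, 3),
    (4, 0), (4, 1), (4, 2)} : Set (Fin 5 × Fin 5))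

end Digraph

/-! Strong bipartite subtournaments are enlarged by moves that preserve strength. A vertex with in-
and out-neighbours on one side joins the other side (`StrongBip.extend_one`). An arc `x y` entered
from one side and left towards the other is an ear, whose ends are added on opposite sides
(`StrongBip.extend_pair`). Where neither move applies, adjacencies are uniform, and four sets
dominating each other cyclically give a new pair (`StrongBip.of_cycle`).

Adding a single vertex can fail, when the vertex dominates one side and is dominated by the other.
Adding two never fails if the whole tournament is strong (`StrongBip.spanned_add_two`). As strong
tournaments have strong subtournaments of every order from 4 up, induction in steps of two leaves
only small orders. Order 4 is a 4-cycle, order 5 a 4-cycle plus one vertex, where `tournamentFive`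
is the only failure. Order 6 is a 4-cycle plus two vertices. Order 7 cannot rest on order 5, so a
4-cycle plus three vertices is treated directly (`spanned_of_four_cycle_add_three`). -/

namespace Tournament

variable {V : Type*} {r : V → V → Prop} {A B C S S' X Y Z W : Set V} {u s w x y z : V}

/-! ### Tournaments and strength via closed sets -/

/-- The relation of a tournament: irreflexive, total on distinct elements and asymmetric. -/
structure IsTourn (r : V → V → Prop) : Prop where
  total : ∀ u v, u ≠ v → r u v ∨ r v u
  asymm : ∀ u v, r u v → ¬ r v u

theorem IsTourn.swap (hr : IsTourn r) : IsTourn (Function.swap r) :=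
  ⟨fun u v h => hr.total v u h.symm, fun u v h => hr.asymm v u h⟩

theorem IsTourn.irrefl (hr : IsTourn r) (v : V) : ¬ r v v := fun h => hr.asymm v v h h

/-- A vertex outside `A` dominates `A`, is dominated by `A`, or has neighbours of both kinds. -/
theorem IsTourn.trichotomy (hr : IsTourn r) (hx : x ∉ A) :
    (∀ a ∈ A, r x a) ∨ (∀ a ∈ A, r a x) ∨ ((∃ a ∈ A, r a x) ∧ ∃ a ∈ A, r x a) := by
  by_cases h1 : ∃ a ∈ A, r a x
  · by_cases h2 : ∃ a ∈ A, r x a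
    · exact Or.inr (Or.inr ⟨h1, h2⟩)
    · push Not at h2
      exact Or.inr (Or.inl fun a ha =>
        (hr.total a x (fun h => hx (h ▸ ha))).resolve_right (h2 a ha))
  · push Not at h1
    exact Or.inl fun a ha => (hr.total a x (fun h => hx (h ▸ ha))).resolve_left (h1 a ha)

/-- `r` is strong on `S`: a subset of `S` closed under out-neighbours in `S` is empty or `S`. -/
def StrongOn (r : V → V → Prop) (S : Set V) : Prop :=
  ∀ U : Set V, (∀ u ∈ S, ∀ v ∈ S, u ∈ U → r u v → v ∈ U) → ∀ u ∈ S, u ∈ U → S ⊆ U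

/-- The complement of a set closed under in-neighbours is closed under out-neighbours. This supplies
the reversed half of later case analyses. -/
theorem StrongOn.swap (h : StrongOn r S) : StrongOn (Function.swap r) S := by
  intro U hU u hu huU w hw
  by_contra hwU
  exact h Uᶜ (fun p hp q hq hpU hpq hqU => hpU (hU q hq p hp hqU hpq)) w hw hwU hu huU

theorem StrongOn.exists_out (h : StrongOn r S) (hx : x ∈ S) (hy : y ∈ S) (hxy : y ≠ x) :
    ∃ v ∈ S, v ≠ x ∧ r x v := by
  by_contra hc
  push Not at hc
  refine hxy (h {x} ?_ x hx rfl hy)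
  rintro u - v hv rfl huv
  by_contra hvu
  exact hc v hv hvu huv

theorem StrongOn.exists_in (h : StrongOn r S) (hx : x ∈ S) (hy : y ∈ S) (hxy : y ≠ x) :
    ∃ v ∈ S, v ≠ x ∧ r v x :=
  h.swap.exists_out hx hy hxy

/-! ### Strong bipartite pairs and their enlargements -/

/-- The arcs of `r` between `A` and `B`. -/
def Cross (r : V → V → Prop) (A B : Set V) (u v : V) : Prop :=
  r u v ∧ (u ∈ A ∧ v ∈ B ∨ u ∈ B ∧ v ∈ A)

/-- The arcs of `r` between the disjoint nonempty sets `A` and `B` form a strong digraph. -/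
structure StrongBip (r : V → V → Prop) (A B : Set V) : Prop where
  disj : Disjoint A B
  left : A.Nonempty
  right : B.Nonempty
  strong : StrongOn (Cross r A B) (A ∪ B)

theorem StrongBip.symm (h : StrongBip r A B) : StrongBip r B A := by
  refine ⟨h.disj.symm, h.right, h.left, ?_⟩
  have : Cross r B A = Cross r A B := by
    ext u v; simp only [Cross]; tauto
  rw [this, Set.union_comm]
  exact h.strong

theorem StrongBip.swap (h : StrongBip r A B) : StrongBip (Function.swap r) A B := by
  refine ⟨h.disj, h.left, h.right, ?_⟩
  have : Cross (Function.swap r) A B = Function.swap (Cross r A B) := by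
    ext u v; simp only [Cross, Function.swap]; tauto
  rw [this]
  exact h.strong.swap

theorem StrongBip.exists_out (h : StrongBip r A B) (hx : x ∈ A) : ∃ b ∈ B, r x b := by
  obtain ⟨b, hb⟩ := h.right
  obtain ⟨v, -, -, hv, h1 | h1⟩ := h.strong.exists_out (Or.inl hx) (Or.inr hb)
    (fun e => Set.disjoint_left.1 h.disj hx (e ▸ hb))
  · exact ⟨v, h1.2, hv⟩
  · exact (Set.disjoint_left.1 h.disj hx h1.1).elim

theorem StrongBip.exists_in (h : StrongBip r A B) (hx : x ∈ A) : ∃ b ∈ B, r b x :=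
  h.swap.exists_out hx

/-- Adding to one side vertices with in- and out-neighbours on the other side. -/
theorem StrongBip.extend (h : StrongBip r A B) (hC : Disjoint C B)
    (hm : ∀ c ∈ C, (∃ b ∈ B, r b c) ∧ ∃ b ∈ B, r c b) : StrongBip r (A ∪ C) B := by
  refine ⟨Set.disjoint_union_left.2 ⟨h.disj, hC⟩, h.left.inl, h.right, ?_⟩
  intro U hU
  have key : ∀ u ∈ A ∪ B, u ∈ U → A ∪ C ∪ B ⊆ U := by
    intro u hu huU
    have hAB : A ∪ B ⊆ U := by
      refine h.strong U (fun p hp q hq hpU hpq => ?_) u hu huU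
      refine hU p ?_ q ?_ hpU ⟨hpq.1, ?_⟩
      · rcases hp with hp | hp <;> simp [hp]
      · rcases hq with hq | hq <;> simp [hq]
      · rcases hpq.2 with h | h <;> simp [h.1, h.2]
    rintro w ((hw | hw) | hw)
    · exact hAB (Or.inl hw)
    · obtain ⟨⟨b, hb, hbw⟩, -⟩ := hm w hw
      exact hU b (by simp [hb]) w (by simp [hw]) (hAB (Or.inr hb)) ⟨hbw, by simp [hb, hw]⟩
    · exact hAB (Or.inr hw)
  rintro u ((hu | hu) | hu) huU
  · exact key u (Or.inl hu) huU
  · obtain ⟨-, b, hb, hub⟩ := hm u hu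
    exact key b (Or.inr hb)
      (hU u (by simp [hu]) b (by simp [hb]) huU ⟨hub, by simp [hb, hu]⟩)
  · exact key u (Or.inr hu) huU

/-- Adding one vertex with in- and out-neighbours on the other side. -/
theorem StrongBip.extend_one (h : StrongBip r A B) (hx : x ∉ B)
    (hm : (∃ b ∈ B, r b x) ∧ ∃ b ∈ B, r x b) : StrongBip r (A ∪ {x}) B :=
  h.extend (Set.disjoint_singleton_left.2 hx) (by rintro c rfl; exact hm)

/-- Adding the ends of an arc `x y` on either side. -/
theorem StrongBip.extend_pair (h : StrongBip r A B) (hx : x ∉ A ∪ B) (hy : y ∉ A ∪ B)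
    (hne : x ≠ y) (hxy : r x y) (hin : ∃ b ∈ B, r b x) (hout : ∃ a ∈ A, r y a) :
    StrongBip r (A ∪ {x}) (B ∪ {y}) := by
  obtain ⟨b, hb, hbx⟩ := hin
  obtain ⟨a, ha, hya⟩ := hout
  simp only [Set.mem_union, not_or] at hx hy
  refine ⟨?_, h.left.inl, h.right.inl, ?_⟩
  · simp [h.disj, hx.2, hy.1, hne.symm]
  intro U hU
  -- The new vertices form the ear `b → x → y → a` attached to the old strong pair.
  have hxyU : x ∈ U → y ∈ U := fun hxU => hU x (by simp) y (by simp) hxU ⟨hxy, by simp⟩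
  have hyaU : y ∈ U → a ∈ U := fun hyU => hU y (by simp) a (by simp [ha]) hyU ⟨hya, by simp [ha]⟩
  have hbxU : b ∈ U → x ∈ U := fun hbU => hU b (by simp [hb]) x (by simp) hbU ⟨hbx, by simp [hb]⟩
  have key : ∀ u ∈ A ∪ B, u ∈ U → A ∪ {x} ∪ (B ∪ {y}) ⊆ U := by
    intro u hu huU
    have hAB : A ∪ B ⊆ U := by
      refine h.strong U (fun p hp q hq hpU hpq => ?_) u hu huU
      refine hU p ?_ q ?_ hpU ⟨hpq.1, ?_⟩
      · rcases hp with hp | hp <;> simp [hp]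
      · rcases hq with hq | hq <;> simp [hq]
      · rcases hpq.2 with h | h <;> simp [h.1, h.2]
    have hxU := hbxU (hAB (Or.inr hb))
    rintro w ((hw | rfl) | (hw | rfl))
    · exact hAB (Or.inl hw)
    · exact hxU
    · exact hAB (Or.inr hw)
    · exact hxyU hxU
  rintro u ((hu | rfl) | (hu | rfl)) huU
  · exact key u (Or.inl hu) huU
  · exact key a (Or.inl ha) (hyaU (hxyU huU))
  · exact key u (Or.inr hu) huU
  · exact key a (Or.inl ha) (hyaU huU)

/-- Four disjoint nonempty sets each of which dominates the next one cyclically. -/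
theorem StrongBip.of_cycle (hX : X.Nonempty) (hY : Y.Nonempty) (hZ : Z.Nonempty) (hW : W.Nonempty)
    (hd : Disjoint (X ∪ Z) (Y ∪ W))
    (hXY : ∀ u ∈ X, ∀ v ∈ Y, r u v) (hYZ : ∀ u ∈ Y, ∀ v ∈ Z, r u v)
    (hZW : ∀ u ∈ Z, ∀ v ∈ W, r u v) (hWX : ∀ u ∈ W, ∀ v ∈ X, r u v) :
    StrongBip r (X ∪ Z) (Y ∪ W) := by
  refine ⟨hd, hX.inl, hY.inl, ?_⟩
  intro U hU
  have h1 : ∀ u ∈ X, u ∈ U → Y ⊆ U := fun u hu huU v hv =>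
    hU u (by simp [hu]) v (by simp [hv]) huU ⟨hXY u hu v hv, by simp [hu, hv]⟩
  have h2 : ∀ u ∈ Y, u ∈ U → Z ⊆ U := fun u hu huU v hv =>
    hU u (by simp [hu]) v (by simp [hv]) huU ⟨hYZ u hu v hv, by simp [hu, hv]⟩
  have h3 : ∀ u ∈ Z, u ∈ U → W ⊆ U := fun u hu huU v hv =>
    hU u (by simp [hu]) v (by simp [hv]) huU ⟨hZW u hu v hv, by simp [hu, hv]⟩
  have h4 : ∀ u ∈ W, u ∈ U → X ⊆ U := fun u hu huU v hv =>
    hU u (by simp [hu]) v (by simp [hv]) huU ⟨hWX u hu v hv, by simp [hu, hv]⟩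
  obtain ⟨p, hp⟩ := hX
  obtain ⟨q, hq⟩ := hY
  obtain ⟨s, hs⟩ := hZ
  obtain ⟨t, ht⟩ := hW
  have key : p ∈ U → X ∪ Z ∪ (Y ∪ W) ⊆ U := by
    intro hpU
    have hYU := h1 p hp hpU
    have hZU := h2 q hq (hYU hq)
    have hWU := h3 s hs (hZU hs)
    exact Set.union_subset (Set.union_subset (h4 t ht (hWU ht)) hZU) (Set.union_subset hYU hWU)
  rintro u ((hu | hu) | (hu | hu)) huU
  · exact key (h4 t ht (h3 s hs (h2 q hq (h1 u hu huU hq) hs) ht) hp)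
  · exact key (h4 t ht (h3 u hu huU ht) hp)
  · exact key (h4 t ht (h3 s hs (h2 u hu huU hs) ht) hp)
  · exact key (h4 u hu huU hp)

theorem StrongBip.of_four_cycle (hr : IsTourn r) {a b c d : V} (hab : r a b) (hbc : r b c)
    (hcd : r c d) (hda : r d a) : StrongBip r {a, c} {b, d} := by
  have := StrongBip.of_cycle (r := r) (X := {a}) (Y := {b}) (Z := {c}) (W := {d})
    (by simp) (by simp) (by simp) (by simp) ?_ (by simpa) (by simpa) (by simpa) (by simpa)
  · simpa [Set.union_comm, Set.pair_comm] using this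
  · have h : ∀ u v, r u v → u ≠ v := fun u v h e => hr.irrefl v (e ▸ h)
    simp [h _ _ hab, (h _ _ hda).symm, (h _ _ hbc).symm, h _ _ hcd, Ne.symm]

/-! ### Adding two vertices -/

/-- `S` is spanned by a strong bipartite tournament of `r`. -/
def Spanned (r : V → V → Prop) (S : Set V) : Prop :=
  ∃ A B, StrongBip r A B ∧ A ∪ B = S

theorem Spanned.swap (h : Spanned (Function.swap r) S) : Spanned r S := by
  obtain ⟨A, B, h, e⟩ := h
  exact ⟨A, B, h.swap, e⟩

/-- An arc from `x` to `A` gives the ear `b → y → x → a`. Otherwise `A` dominates `x`, and `y → A →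
x → B' → y` is a cycle of sets, with `B'` the out-neighbours of `x` in `B`. The rest of `B` has
neighbours of both kinds in `A`, so it joins the side of `x` and `y`. -/
theorem StrongBip.spanned_of_stuck (hr : IsTourn r) (h : StrongBip r A B) (hx : x ∉ A ∪ B)
    (hy : y ∉ A ∪ B) (hxy : x ≠ y) (hm : ∃ b ∈ B, r x b)
    (hyA : ∀ a ∈ A, r y a) (hyx : r y x) (hBy : ∀ b ∈ B, r b y) :
    Spanned r (A ∪ B ∪ {x, y}) := by
  by_cases hxa : ∃ a ∈ A, r x a
  · obtain ⟨b, hb⟩ := h.right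
    refine ⟨_, _, h.extend_pair hy hx hxy.symm hyx ⟨b, hb, hBy b hb⟩ hxa, ?_⟩
    ext v; simp; clear * -; tauto
  · simp only [Set.mem_union, not_or] at hx hy
    have hAx : ∀ a ∈ A, r a x := by
      push Not at hxa
      exact fun a ha => (hr.total a x (fun e => hx.1 (e ▸ ha))).resolve_right (hxa a ha)
    have h4 := StrongBip.of_cycle (r := r) (X := {y}) (Y := A) (Z := {x}) (W := {b ∈ B | r x b})
      (by simp) h.left (by simp) hm (by simp [hx, hy]) (by simpa) (by simpa) (by simp)
      (by simp only [Set.mem_singleton_iff]; rintro u ⟨hu, -⟩ v rfl; exact hBy u hu)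
    refine ⟨_, _, h4.extend (C := {b ∈ B | ¬ r x b}) ?_ ?_, ?_⟩
    · rw [Set.disjoint_left]
      rintro c ⟨hc, hxc⟩ (hc' | ⟨-, hc'⟩)
      · exact Set.disjoint_left.1 h.disj hc' hc
      · exact hxc hc'
    · rintro c ⟨hc, -⟩
      obtain ⟨a, ha, hac⟩ := h.symm.exists_in hc
      obtain ⟨a', ha', hac'⟩ := h.symm.exists_out hc
      exact ⟨⟨a, Or.inl ha, hac⟩, a', Or.inl ha', hac'⟩
    · ext v; simp; clear * -; tauto

/-- First `x` joins `A`. If `y` then has mixed neighbours on no side, strength forbids it to be a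
source or a sink, so it dominates one side and is dominated by the other: the stuck configuration or
its reversal. -/
theorem StrongBip.spanned_of_mixed (hr : IsTourn r) (h : StrongBip r A B)
    (hS : StrongOn r (A ∪ B ∪ {x, y})) (hx : x ∉ A ∪ B)
    (hy : y ∉ A ∪ B) (hxy : x ≠ y) (hm : (∃ b ∈ B, r b x) ∧ ∃ b ∈ B, r x b) :
    Spanned r (A ∪ B ∪ {x, y}) := by
  have hx' := hx
  have hy' := hy
  simp only [Set.mem_union, not_or] at hx' hy'
  have h1 : StrongBip r (A ∪ {x}) B := h.extend_one hx'.2 hm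
  have hxS : x ∈ A ∪ B ∪ {x, y} := by simp
  have hyS : y ∈ A ∪ B ∪ {x, y} := by simp
  obtain ⟨p, hp, hpy, hyp⟩ := hS.exists_out hyS hxS hxy
  obtain ⟨q, hq, hqy, hqy'⟩ := hS.exists_in hyS hxS hxy
  have hpm : (p ∈ A ∨ p = x) ∨ p ∈ B := by simp at hp; clear * - hp hpy; tauto
  have hqm : (q ∈ A ∨ q = x) ∨ q ∈ B := by simp at hq; clear * - hq hqy; tauto
  rcases hr.trichotomy hy'.2 with hB | hB | hB
  · rcases hr.trichotomy (A := A ∪ {x}) (x := y) (by simp [hy', hxy.symm]) with hA | hA | hA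
    · rcases hqm with hqm | hqm
      · exact (hr.asymm _ _ hqy' (hA q hqm)).elim
      · exact (hr.asymm _ _ hqy' (hB q hqm)).elim
    · refine Spanned.swap (h.swap.spanned_of_stuck hr.swap hx hy hxy hm.1 ?_ ?_ ?_)
      · exact fun a ha => hA a (Or.inl ha)
      · exact hA x (by simp)
      · exact hB
    · refine ⟨_, _, h1.symm.extend_one (x := y) (by simp [hy', hxy.symm]) hA, ?_⟩
      ext v; simp only [Set.mem_union, Set.mem_insert_iff, Set.mem_singleton_iff]; clear * -; tauto
  · rcases hr.trichotomy (A := A ∪ {x}) (x := y) (by simp [hy', hxy.symm]) with hA | hA | hA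
    · refine h.spanned_of_stuck hr hx hy hxy hm.2 ?_ ?_ ?_
      · exact fun a ha => hA a (Or.inl ha)
      · exact hA x (by simp)
      · exact hB
    · rcases hpm with hpm | hpm
      · exact (hr.asymm _ _ hyp (hA p hpm)).elim
      · exact (hr.asymm _ _ hyp (hB p hpm)).elim
    · refine ⟨_, _, h1.symm.extend_one (x := y) (by simp [hy', hxy.symm]) hA, ?_⟩
      ext v; simp only [Set.mem_union, Set.mem_insert_iff, Set.mem_singleton_iff]; clear * -; tauto
  · refine ⟨_, _, h1.extend_one (x := y) hy'.2 hB, ?_⟩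
    ext v; simp only [Set.mem_union, Set.mem_insert_iff, Set.mem_singleton_iff]; clear * -; tauto

theorem StrongBip.opposite_pair (h : StrongBip r A B) (hx : x ∉ A ∪ B) (hy : y ∉ A ∪ B)
    (hxA : ∀ a ∈ A, r x a) (hAy : ∀ a ∈ A, r a y) (hyB : ∀ b ∈ B, r y b) (hBx : ∀ b ∈ B, r b x) :
    StrongBip r ({x} ∪ {y}) (A ∪ B) := by
  simp only [Set.mem_union, not_or] at hx hy
  exact StrongBip.of_cycle (by simp) h.left (by simp) h.right (by simp [hx, hy])
    (by simpa) (by simpa) (by simpa) (by simpa)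

/-- Without an ear or a mixed vertex, `x` and `y` are each uniform to both sides. Strength gives `x`
an in-neighbour and `y` an out-neighbour in `A ∪ B`. The only patterns left are the cycle of sets `x
→ A → y → B → x` and the one with `x` and `y` exchanged. -/
theorem StrongBip.spanned_of_arc (hr : IsTourn r) (h : StrongBip r A B)
    (hS : StrongOn r (A ∪ B ∪ {x, y})) (hx : x ∉ A ∪ B)
    (hy : y ∉ A ∪ B) (hxy : x ≠ y) (hr' : r x y) : Spanned r (A ∪ B ∪ {x, y}) := by
  have hx' := hx
  have hy' := hy
  simp only [Set.mem_union, not_or] at hx' hy'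
  have hxS : x ∈ A ∪ B ∪ {x, y} := by simp
  have hyS : y ∈ A ∪ B ∪ {x, y} := by simp
  have hyx : A ∪ B ∪ {y, x} = A ∪ B ∪ {x, y} := by rw [Set.pair_comm]
  have hBA : B ∪ A ∪ {x, y} = A ∪ B ∪ {x, y} := by rw [Set.union_comm B A]
  have hBA' : B ∪ A ∪ {y, x} = A ∪ B ∪ {x, y} := by rw [Set.union_comm B A, Set.pair_comm]
  obtain ⟨p, hp, hpy, hyp⟩ := hS.exists_out hyS hxS hxy
  obtain ⟨q, hq, hqx, hqx'⟩ := hS.exists_in hxS hyS hxy.symm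
  have hpm : p ∈ A ∨ p ∈ B := by
    simp only [Set.mem_union, Set.mem_insert_iff, Set.mem_singleton_iff] at hp
    rcases hp with hp | rfl | hp
    · exact hp
    · exact (hr.asymm _ _ hr' hyp).elim
    · exact (hpy hp).elim
  have hqm : q ∈ A ∨ q ∈ B := by
    simp only [Set.mem_union, Set.mem_insert_iff, Set.mem_singleton_iff] at hq
    rcases hq with hq | hq | rfl
    · exact hq
    · exact (hqx hq).elim
    · exact (hr.asymm _ _ hr' hqx').elim
  obtain ⟨a, ha⟩ := h.left
  obtain ⟨b, hb⟩ := h.right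
  by_cases h1 : (∃ b ∈ B, r b x) ∧ ∃ a ∈ A, r y a
  · exact ⟨_, _, h.extend_pair hx hy hxy hr' h1.1 h1.2, by ext v; simp only [Set.mem_union, Set.mem_insert_iff, Set.mem_singleton_iff]; clear * -; tauto⟩
  by_cases h2 : (∃ b ∈ A, r b x) ∧ ∃ a ∈ B, r y a
  · exact ⟨_, _, h.symm.extend_pair (by rwa [Set.union_comm]) (by rwa [Set.union_comm]) hxy hr' h2.1 h2.2,
      by ext v; simp only [Set.mem_union, Set.mem_insert_iff, Set.mem_singleton_iff]; clear * -; tauto⟩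
  rcases hr.trichotomy hx'.2 with xB | xB | xB
  rotate_left 2
  · exact h.spanned_of_mixed hr hS hx hy hxy xB
  all_goals
    rcases hr.trichotomy hx'.1 with xA | xA | xA
    rotate_left 2
    · rw [← hBA] at hS ⊢
      exact h.symm.spanned_of_mixed hr hS (by rwa [Set.union_comm]) (by rwa [Set.union_comm]) hxy xA
  all_goals
    rcases hr.trichotomy hy'.2 with yB | yB | yB
    rotate_left 2
    · rw [← hyx] at hS ⊢
      exact h.spanned_of_mixed hr hS hy hx hxy.symm yB
  all_goals
    rcases hr.trichotomy hy'.1 with yA | yA | yA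
    rotate_left 2
    · rw [← hBA'] at hS ⊢
      exact h.symm.spanned_of_mixed hr hS (by rwa [Set.union_comm]) (by rwa [Set.union_comm]) hxy.symm yA
  all_goals
    first
    | exact (h1 ⟨⟨b, hb, xB b hb⟩, a, ha, yA a ha⟩).elim
    | exact (h2 ⟨⟨a, ha, xA a ha⟩, b, hb, yB b hb⟩).elim
    | exact (hqm.elim (fun hq => hr.asymm _ _ hqx' (xA q hq))
        fun hq => hr.asymm _ _ hqx' (xB q hq)).elim
    | exact (hpm.elim (fun hp => hr.asymm _ _ hyp (yA p hp))
        fun hp => hr.asymm _ _ hyp (yB p hp)).elim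
    | exact ⟨_, _, h.opposite_pair hx hy xA yA yB xB, by
        rw [Set.union_comm, Set.insert_eq]⟩
    | exact ⟨_, _, h.opposite_pair hy hx yA xA xB yB, by
        rw [Set.union_comm, ← hyx, Set.insert_eq y]⟩

/-- If all but two vertices are spanned by a strong bipartite tournament, so are all of them. -/
theorem StrongBip.spanned_add_two (hr : IsTourn r) (h : StrongBip r A B) (hS : StrongOn r S)
    (hx : x ∉ A ∪ B) (hy : y ∉ A ∪ B) (hxy : x ≠ y) (e : S = A ∪ B ∪ {x, y}) :
    Spanned r S := by
  subst e
  rcases hr.total x y hxy with h1 | h1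
  · exact h.spanned_of_arc hr hS hx hy hxy h1
  · rw [Set.pair_comm] at hS ⊢
    exact h.spanned_of_arc hr hS hy hx hxy.symm h1

/-! ### Obstructions to adding one or three vertices -/

/-- A vertex `v` that dominates `A` and is dominated by `B`. -/
def Splits (r : V → V → Prop) (A B : Set V) (v : V) : Prop :=
  (∀ a ∈ A, r v a) ∧ ∀ b ∈ B, r b v

theorem Splits.swap (h : Splits (Function.swap r) A B x) : Splits r B A x :=
  ⟨h.2, h.1⟩

/-- A vertex that cannot be added to a strong bipartite subdigraph has one of four types. -/
theorem StrongBip.types (hr : IsTourn r) (h : StrongBip r A B) (hx : x ∉ A ∪ B)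
    (hno : ¬ Spanned r (A ∪ B ∪ {x})) :
    (∀ v ∈ A ∪ B, r x v) ∨ (∀ v ∈ A ∪ B, r v x) ∨ Splits r A B x ∨ Splits r B A x := by
  have hx' := hx
  simp only [Set.mem_union, not_or] at hx'
  rcases hr.trichotomy hx'.1 with hA | hA | hA
  · rcases hr.trichotomy hx'.2 with hB | hB | hB
    · exact Or.inl fun v hv => hv.elim (hA v) (hB v)
    · exact Or.inr (Or.inr (Or.inl ⟨hA, hB⟩))
    · exact (hno ⟨_, _, h.extend_one hx'.2 hB, Set.union_right_comm _ _ _⟩).elim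
  · rcases hr.trichotomy hx'.2 with hB | hB | hB
    · exact Or.inr (Or.inr (Or.inr ⟨hB, hA⟩))
    · exact Or.inr (Or.inl fun v hv => hv.elim (hA v) (hB v))
    · exact (hno ⟨_, _, h.extend_one hx'.2 hB, Set.union_right_comm _ _ _⟩).elim
  · refine (hno ⟨_, _, h.symm.extend_one hx'.1 hA, ?_⟩).elim
    rw [Set.union_right_comm, Set.union_comm B A]

/-- Of the four types, strength of the whole excludes a source and a sink. -/
theorem StrongBip.splits_of_add_one (hr : IsTourn r) (h : StrongBip r A B)
    (hS : StrongOn r S) (hx : x ∉ A ∪ B) (e : S = A ∪ B ∪ {x}) (hno : ¬ Spanned r S) :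
    Splits r A B x ∨ Splits r B A x := by
  subst e
  obtain ⟨a, ha⟩ := h.left
  have hax : a ≠ x := fun e => hx (e ▸ Or.inl ha)
  rcases h.types hr hx hno with h1 | h1 | h1
  · obtain ⟨v, hv, hvx, hvr⟩ := hS.exists_in (x := x) (y := a) (by simp) (by simp [ha]) hax
    exact (hr.asymm _ _ hvr (h1 v (hv.resolve_right hvx))).elim
  · obtain ⟨v, hv, hvx, hvr⟩ := hS.exists_out (x := x) (y := a) (by simp) (by simp [ha]) hax
    exact (hr.asymm _ _ hvr (h1 v (hv.resolve_right hvx))).elim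
  · exact h1

/-- The ear `b → u → s → a` absorbs `u` and `s`, so a failing `w` splits the enlarged pair, hence
the old one, and `A` dominates `u`. One orientation gives the cycle of sets `s → B → w → u → s`,
with `A` joining `s` and `w`. The other gives the ear `a → u → w → b`, after which `s` is mixed
through `w → s → a`. -/
theorem StrongBip.spanned_of_dominator_aux (hr : IsTourn r) (h : StrongBip r A B)
    (hS : StrongOn r S) (hu : u ∉ A ∪ B) (hs : s ∉ A ∪ B) (hw : w ∉ A ∪ B)
    (hus : u ≠ s) (huw : u ≠ w) (hsw : s ≠ w) (e : S = A ∪ B ∪ {u, s, w})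
    (hrus : r u s) (hsO : ∀ v ∈ A ∪ B, r s v) (hBu : ∀ b ∈ B, r b u)
    (hw' : Splits r A B w ∨ Splits r B A w → ∀ a ∈ A, r a u) : Spanned r S := by
  by_contra hno
  have hu' := hu
  have hs' := hs
  have hw'' := hw
  simp only [Set.mem_union, not_or] at hu' hs' hw''
  obtain ⟨a, ha⟩ := h.left
  obtain ⟨b, hb⟩ := h.right
  have h1 := h.extend_pair hu hs hus hrus ⟨b, hb, hBu b hb⟩ ⟨a, ha, hsO a (Or.inl ha)⟩
  rcases h1.splits_of_add_one hr hS (x := w) (by simp [hw'', huw.symm, hsw.symm])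
    (by rw [e]; ext v; simp; clear * -; tauto) hno with h2 | h2
  · have hA := hw' (Or.inl ⟨fun a ha => h2.1 a (Or.inl ha), fun b hb => h2.2 b (Or.inl hb)⟩)
    have h3 := StrongBip.of_cycle (r := r) (X := {s}) (Y := B) (Z := {w}) (W := {u})
      (by simp) h.right (by simp) (by simp) (by simp [hs', hw'', hus, huw])
      (by simpa using fun b hb => hsO b (Or.inr hb)) (by simpa using fun b hb => h2.2 b (Or.inl hb))
      (by simpa using h2.1 u (by simp)) (by simpa)
    refine hno ⟨_, _, h3.extend (C := A) ?_ ?_, ?_⟩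
    · simp [h.disj, hu']
    · intro c hc
      obtain ⟨b', hb', hb''⟩ := h.exists_in hc
      exact ⟨⟨b', Or.inl hb', hb''⟩, u, Or.inr rfl, hA c hc⟩
    · rw [e]; ext v; simp; clear * -; tauto
  · have hA := hw' (Or.inr ⟨fun a ha => h2.1 a (Or.inl ha), fun b hb => h2.2 b (Or.inl hb)⟩)
    have h3 := h.symm.extend_pair (x := u) (y := w) (by rwa [Set.union_comm])
      (by rwa [Set.union_comm]) huw (h2.2 u (by simp)) ⟨a, ha, hA a ha⟩
      ⟨b, hb, h2.1 b (Or.inl hb)⟩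
    refine hno ⟨_, _, h3.extend_one (x := s) (by simp [hs', hsw])
      ⟨⟨w, by simp, h2.1 s (by simp)⟩, a, Or.inl ha, hsO a (Or.inl ha)⟩, ?_⟩
    rw [e]; ext v; simp; clear * -; tauto

/-- Three further vertices one of which dominates the strong bipartite subdigraph. -/
theorem StrongBip.spanned_of_dominator (hr : IsTourn r) (h : StrongBip r A B)
    (hS : StrongOn r S) (hx : x ∉ A ∪ B) (hy : y ∉ A ∪ B) (hz : z ∉ A ∪ B)
    (hxy : x ≠ y) (hxz : x ≠ z) (hyz : y ≠ z) (e : S = A ∪ B ∪ {x, y, z})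
    (ht : ∀ v ∈ ({x, y, z} : Set V), (∀ t ∈ A ∪ B, r v t) ∨ (∀ t ∈ A ∪ B, r t v) ∨
      Splits r A B v ∨ Splits r B A v)
    (hM : ∀ v ∈ ({x, y, z} : Set V), ∀ w ∈ ({x, y, z} : Set V), v ≠ w →
      Splits r A B v ∨ Splits r B A v → Splits r A B w ∨ Splits r B A w → False)
    (hO : ∃ v ∈ ({x, y, z} : Set V), ∀ t ∈ A ∪ B, r v t) : Spanned r S := by
  obtain ⟨a, ha⟩ := h.left
  obtain ⟨b, hb⟩ := h.right
  have hR : ∀ v ∈ ({x, y, z} : Set V), v ∉ A ∪ B := by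
    rintro v (rfl | rfl | rfl) <;> assumption
  -- Otherwise the dominating vertices would be closed under in-neighbours, and by strength would
  -- include a vertex of `A`.
  obtain ⟨s, hs, hsO, u, hu, huO, hus⟩ : ∃ s ∈ ({x, y, z} : Set V), (∀ t ∈ A ∪ B, r s t) ∧
      ∃ u ∈ ({x, y, z} : Set V), (¬ ∀ t ∈ A ∪ B, r u t) ∧ r u s := by
    by_contra hc
    push Not at hc
    obtain ⟨v, hv, hvO⟩ := hO
    have hsub := hS.swap {v | v ∈ ({x, y, z} : Set V) ∧ ∀ t ∈ A ∪ B, r v t} ?_ v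
      (by rw [e]; exact Or.inr hv) ⟨hv, hvO⟩
    · have := hsub (show a ∈ S by rw [e]; simp [ha])
      exact hR a this.1 (Or.inl ha)
    · rintro p hp q hq ⟨hpR, hpO⟩ (hqp : r q p)
      rw [e] at hq
      rcases hq with hq | hq
      · exact (hr.asymm _ _ hqp (hpO q hq)).elim
      · by_contra hqU
        obtain ⟨t, ht, htq⟩ : ∃ t ∈ A ∪ B, ¬ r q t := by
          by_contra hcc
          push Not at hcc
          exact hqU ⟨hq, hcc⟩
        exact hc p hpR hpO q hq ⟨t, ht, htq⟩ hqp
  have hne : u ≠ s := fun e => hr.irrefl s (e ▸ hus)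
  obtain ⟨w, hw, huw, hsw, e'⟩ : ∃ w ∈ ({x, y, z} : Set V), u ≠ w ∧ s ≠ w ∧
      ({x, y, z} : Set V) = {u, s, w} := by
    have e1 : ({x, y, z} : Set V) = {x, z, y} := by ext; simp; clear * -; tauto
    have e2 : ({x, y, z} : Set V) = {y, x, z} := by ext; simp; clear * -; tauto
    have e3 : ({x, y, z} : Set V) = {y, z, x} := by ext; simp; clear * -; tauto
    have e4 : ({x, y, z} : Set V) = {z, x, y} := by ext; simp; clear * -; tauto
    have e5 : ({x, y, z} : Set V) = {z, y, x} := by ext; simp; clear * -; tauto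
    rcases hu with hu | hu | hu <;> rcases hs with hs | hs | hs <;> rw [hu, hs] at hne <;>
      rw [hu, hs]
    · exact (hne rfl).elim
    · exact ⟨z, by simp, hxz, hyz, rfl⟩
    · exact ⟨y, by simp, hxy, hyz.symm, e1⟩
    · exact ⟨z, by simp, hyz, hxz, e2⟩
    · exact (hne rfl).elim
    · exact ⟨x, by simp, hxy.symm, hxz.symm, e3⟩
    · exact ⟨y, by simp, hyz.symm, hxy, e4⟩
    · exact ⟨x, by simp, hxz.symm, hxy.symm, e5⟩
    · exact (hne rfl).elim
  have hMuw := hM u hu w hw huw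
  rw [e'] at e
  have hBA : S = B ∪ A ∪ {u, s, w} := by rw [e, Set.union_comm B A]
  -- If `u` splits the pair, then `w` does not, so the last hypothesis of the auxiliary lemma is
  -- vacuous.
  rcases ht u hu with h1 | h1 | h1 | h1
  · exact (huO h1).elim
  · exact h.spanned_of_dominator_aux hr hS (hR u hu) (hR s hs) (hR w hw) hne huw hsw e hus hsO
      (fun b hb => h1 b (Or.inr hb)) fun _ a ha => h1 a (Or.inl ha)
  · exact h.spanned_of_dominator_aux hr hS (hR u hu) (hR s hs) (hR w hw) hne huw hsw e hus hsO
      h1.2 fun hsp => (hMuw (Or.inl h1) hsp).elim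
  · rw [Set.union_comm A B] at hR hsO
    exact h.symm.spanned_of_dominator_aux hr hS (hR u hu) (hR s hs) (hR w hw) hne huw hsw hBA hus
      hsO h1.2 fun hsp => (hMuw (Or.inr h1) hsp.symm).elim

/-! ### A 4-cycle and three further vertices -/

section FourCycle

variable {a b c d v : V}

/-- The chord `a c` yields the 4-cycle `x → a → c → d → x`, and `y` joins through `d → y → a`. Only
`b` and `z` remain. -/
theorem spanned_of_two_splits_aux (hr : IsTourn r) (hS : StrongOn r S)
    (hab : r a b) (hbc : r b c) (hcd : r c d) (hda : r d a) (hac : r a c)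
    (hA : A = {a, c}) (hB : B = {b, d})
    (hx : x ∉ A ∪ B) (hy : y ∉ A ∪ B) (hz : z ∉ A ∪ B)
    (hxz : x ≠ z) (hyz : y ≠ z) (e : S = A ∪ B ∪ {x, y, z})
    (hxs : Splits r A B x) (hys : Splits r A B y) : Spanned r S := by
  subst hA hB
  have hne : ∀ p q, r p q → p ≠ q := fun p q h e => hr.irrefl p (e ▸ h)
  have hab' := hne _ _ hab
  have hbc' := hne _ _ hbc
  have hbd : b ≠ d := fun e => hr.asymm _ _ hda (e ▸ hab)
  simp only [Set.mem_union, Set.mem_insert_iff, Set.mem_singleton_iff, not_or] at hx hy hz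
  simp only [Splits, Set.mem_insert_iff, Set.mem_singleton_iff, forall_eq_or_imp,
    forall_eq] at hxs hys
  have h1 := StrongBip.of_four_cycle hr hxs.1.1 hac hcd hxs.2.2
  have h2 := h1.extend_one (x := y) (by simp [hy]) ⟨⟨d, by simp, hys.2.2⟩, a, by simp, hys.1.1⟩
  refine h2.spanned_add_two hr hS (x := b) (y := z) ?_ ?_ ?_ ?_
  · simp only [Set.mem_union, Set.mem_insert_iff, Set.mem_singleton_iff]
    grind
  · simp only [Set.mem_union, Set.mem_insert_iff, Set.mem_singleton_iff]
    grind
  · exact Ne.symm hz.2.1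
  · rw [e]; ext; simp; clear * -; tauto

theorem spanned_of_two_splits (hr : IsTourn r) (hS : StrongOn r S)
    (hab : r a b) (hbc : r b c) (hcd : r c d) (hda : r d a)
    (hA : A = {a, c}) (hB : B = {b, d})
    (hx : x ∉ A ∪ B) (hy : y ∉ A ∪ B) (hz : z ∉ A ∪ B)
    (hxz : x ≠ z) (hyz : y ≠ z) (e : S = A ∪ B ∪ {x, y, z})
    (hxs : Splits r A B x) (hys : Splits r A B y) : Spanned r S := by
  have hac : a ≠ c := fun e => hr.asymm _ _ hbc (e ▸ hab)
  rcases hr.total a c hac with h | h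
  · exact spanned_of_two_splits_aux hr hS hab hbc hcd hda h hA hB hx hy hz hxz hyz e hxs hys
  · exact spanned_of_two_splits_aux hr hS hcd hda hab hbc h (hA.trans (Set.pair_comm _ _))
      (hB.trans (Set.pair_comm _ _)) hx hy hz hxz hyz e hxs hys

theorem spanned_of_opposite_splits (hr : IsTourn r) (hS : StrongOn r S)
    (hab : r a b) (hbc : r b c) (hcd : r c d)
    (hA : A = {a, c}) (hB : B = {b, d})
    (hx : x ∉ A ∪ B) (hy : y ∉ A ∪ B) (hz : z ∉ A ∪ B)
    (hxz : x ≠ z) (hyz : y ≠ z) (e : S = A ∪ B ∪ {x, y, z})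
    (hxs : Splits r A B x) (hys : Splits r B A y) : Spanned r S := by
  subst hA hB
  have hne : ∀ p q, r p q → p ≠ q := fun p q h e => hr.irrefl p (e ▸ h)
  have hab' := hne _ _ hab
  have hbc' := hne _ _ hbc
  have hcd' := hne _ _ hcd
  have hac : a ≠ c := fun e => hr.asymm _ _ hbc (e ▸ hab)
  simp only [Set.mem_union, Set.mem_insert_iff, Set.mem_singleton_iff, not_or] at hx hy hz
  -- The vertex `c` is left out on purpose: exactly two vertices, `c` and `z`, must remain.
  have h1 := StrongBip.of_cycle (r := r) (X := {x}) (Y := {a}) (Z := {y}) (W := {b, d})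
    (by simp) (by simp) (by simp) (by simp) (by simp; grind) (by simpa using hxs.1 a (by simp))
    (by simpa using hys.2 a (by simp)) (by simpa using hys.1) (by simpa using hxs.2)
  refine h1.spanned_add_two hr hS (x := c) (y := z) ?_ ?_ ?_ ?_
  · simp only [Set.mem_union, Set.mem_insert_iff, Set.mem_singleton_iff]
    grind
  · simp only [Set.mem_union, Set.mem_insert_iff, Set.mem_singleton_iff]
    grind
  · grind
  · rw [e]; ext; simp; clear * -; tauto

/-- A 4-cycle and three further vertices. -/
theorem spanned_of_four_cycle_add_three (hr : IsTourn r) (hS : StrongOn r S)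
    (hab : r a b) (hbc : r b c) (hcd : r c d) (hda : r d a)
    (hA : A = {a, c}) (hB : B = {b, d})
    (hx : x ∉ A ∪ B) (hy : y ∉ A ∪ B) (hz : z ∉ A ∪ B)
    (hxy : x ≠ y) (hxz : x ≠ z) (hyz : y ≠ z) (e : S = A ∪ B ∪ {x, y, z}) : Spanned r S := by
  have h : StrongBip r A B := by
    rw [hA, hB]; exact StrongBip.of_four_cycle hr hab hbc hcd hda
  by_contra hno
  -- If `u` could be added, the other two could be added together. So every vertex has one of the
  -- four types, and no two of them split the pair.
  have key : ∀ u v w, u ∉ A ∪ B → v ∉ A ∪ B → w ∉ A ∪ B → u ≠ v → u ≠ w → v ≠ w →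
      S = A ∪ B ∪ {u, v, w} → ((∀ t ∈ A ∪ B, r u t) ∨ (∀ t ∈ A ∪ B, r t u) ∨
      Splits r A B u ∨ Splits r B A u) ∧
      (Splits r A B u ∨ Splits r B A u → Splits r A B v ∨ Splits r B A v → False) := by
    intro u v w hu hv hw huv huw hvw e
    refine ⟨h.types hr hu ?_, ?_⟩
    · rintro ⟨A', B', h', e'⟩
      refine hno (h'.spanned_add_two hr hS (x := v) (y := w) ?_ ?_ hvw ?_)
      · rw [e']; simpa [huv.symm] using hv
      · rw [e']; simpa [huw.symm] using hw
      · rw [e', e]; ext; simp; clear * -; tauto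
    · have e' : S = A ∪ B ∪ {v, u, w} := by rw [e]; ext; simp; clear * -; tauto
      rintro (h1 | h1) (h2 | h2)
      · exact hno (spanned_of_two_splits hr hS hab hbc hcd hda hA hB hu hv hw huw hvw e h1 h2)
      · exact hno (spanned_of_opposite_splits hr hS hab hbc hcd hA hB hu hv hw huw hvw e h1 h2)
      · exact hno (spanned_of_opposite_splits hr hS hab hbc hcd hA hB hv hu hw hvw huw e' h2 h1)
      · rw [Set.union_comm A B] at hu hv hw e
        exact hno (spanned_of_two_splits hr hS hbc hcd hda hab hB (hA.trans (Set.pair_comm _ _))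
          hu hv hw huw hvw e h1 h2)
  have e1 : S = A ∪ B ∪ {x, z, y} := by rw [e]; ext; simp; clear * -; tauto
  have e2 : S = A ∪ B ∪ {y, x, z} := by rw [e]; ext; simp; clear * -; tauto
  have e3 : S = A ∪ B ∪ {y, z, x} := by rw [e]; ext; simp; clear * -; tauto
  have e4 : S = A ∪ B ∪ {z, x, y} := by rw [e]; ext; simp; clear * -; tauto
  have e5 : S = A ∪ B ∪ {z, y, x} := by rw [e]; ext; simp; clear * -; tauto
  have kxy := key x y z hx hy hz hxy hxz hyz e
  have kxz := key x z y hx hz hy hxz hxy hyz.symm e1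
  have kyx := key y x z hy hx hz hxy.symm hyz hxz e2
  have kyz := key y z x hy hz hx hyz hxy.symm hxz.symm e3
  have kzx := key z x y hz hx hy hxz.symm hyz.symm hxy e4
  have kzy := key z y x hz hy hx hyz.symm hxz.symm hxy.symm e5
  have ht : ∀ v ∈ ({x, y, z} : Set V), (∀ t ∈ A ∪ B, r v t) ∨ (∀ t ∈ A ∪ B, r t v) ∨
      Splits r A B v ∨ Splits r B A v := by
    rintro v (rfl | rfl | rfl)
    exacts [kxy.1, kyx.1, kzx.1]
  have hM : ∀ v ∈ ({x, y, z} : Set V), ∀ w ∈ ({x, y, z} : Set V), v ≠ w →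
      Splits r A B v ∨ Splits r B A v → Splits r A B w ∨ Splits r B A w → False := by
    rintro v hv w hw hvw
    rcases hv with hv | hv | hv <;> rcases hw with hw | hw | hw <;> rw [hv, hw] at hvw ⊢
    exacts [(hvw rfl).elim, kxy.2, kxz.2, kyx.2, (hvw rfl).elim, kyz.2, kzx.2, kzy.2,
      (hvw rfl).elim]
  by_cases hO : ∃ v ∈ ({x, y, z} : Set V), ∀ t ∈ A ∪ B, r v t
  · exact hno (h.spanned_of_dominator hr hS hx hy hz hxy hxz hyz e ht hM hO)
  · have hI : ∃ v ∈ ({x, y, z} : Set V), ∀ t ∈ A ∪ B, r t v := by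
      by_contra hI
      push Not at hI hO
      have hs : ∀ v ∈ ({x, y, z} : Set V), Splits r A B v ∨ Splits r B A v := by
        intro v hv
        obtain ⟨t, ht1, ht2⟩ := hI v hv
        obtain ⟨t', ht1', ht2'⟩ := hO v hv
        exact ((ht v hv).resolve_left fun h => ht2' (h t' ht1')).resolve_left
          fun h => ht2 (h t ht1)
      exact kxy.2 (hs x (by simp)) (hs y (by simp))
    refine hno (Spanned.swap (h.swap.spanned_of_dominator hr.swap hS.swap hx hy hz hxy hxz hyz e
      ?_ ?_ hI))
    · intro v hv
      rcases ht v hv with h1 | h1 | h1 | h1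
      exacts [Or.inr (Or.inl h1), Or.inl h1, Or.inr (Or.inr (Or.inr ⟨h1.2, h1.1⟩)),
        Or.inr (Or.inr (Or.inl ⟨h1.2, h1.1⟩))]
    · intro v hv w hw hvw h1 h2
      exact hM v hv w hw hvw (h1.symm.imp Splits.swap Splits.swap)
        (h2.symm.imp Splits.swap Splits.swap)

end FourCycle

/-! ### Strong subtournaments of prescribed order -/

/-- A proper nonempty subset of a strong tournament is adjoined by a vertex with neighbours of both
kinds in it, or by an arc from a vertex it dominates to a vertex dominating it. -/
theorem StrongOn.exists_mixed_or_arc (hr : IsTourn r) (hS : StrongOn r S) (hsub : S' ⊆ S)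
    (hne : S'.Nonempty) (hneq : S' ≠ S) :
    (∃ t ∈ S \ S', (∃ s ∈ S', r s t) ∧ ∃ s ∈ S', r t s) ∨
      ∃ p ∈ S \ S', ∃ q ∈ S \ S', (∀ s ∈ S', r s p) ∧ r p q ∧ ∀ s ∈ S', r q s := by
  by_contra hc
  push Not at hc
  obtain ⟨hmix, harc⟩ := hc
  obtain ⟨s, hs⟩ := hne
  have hdich : ∀ t ∈ S \ S', (∀ s ∈ S', r t s) ∨ ∀ s ∈ S', r s t := by
    intro t ht
    rcases hr.trichotomy ht.2 with h | h | ⟨⟨p, hp, hpt⟩, q, hq, hqt⟩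
    · exact Or.inl h
    · exact Or.inr h
    · exact (hmix t ht ⟨p, hp, hpt⟩ q hq hqt).elim
  have hp : ∃ p ∈ S \ S', ∀ s ∈ S', r s p := by
    by_contra hp
    push Not at hp
    refine hneq (hsub.antisymm (hS S' (fun u hu v hv huS huv => ?_) s (hsub hs) hs))
    by_contra hvS
    rcases hdich v ⟨hv, hvS⟩ with h | h
    · exact hr.asymm _ _ huv (h u huS)
    · obtain ⟨w, hw, hwv⟩ := hp v ⟨hv, hvS⟩
      exact hwv (h w hw)
  obtain ⟨p, hp, hpS⟩ := hp
  refine (hS {t | t ∈ S \ S' ∧ ∀ s ∈ S', r s t} ?_ p hp.1 ⟨hp, hpS⟩ (hsub hs)).1.2 hs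
  rintro u - v hv ⟨hu, huS⟩ huv
  have hvS : v ∉ S' := fun h => hr.asymm _ _ huv (huS v h)
  refine ⟨⟨hv, hvS⟩, (hdich v ⟨hv, hvS⟩).resolve_left fun h => ?_⟩
  obtain ⟨w, hw, hwv⟩ := harc u hu v ⟨hv, hvS⟩ huS huv
  exact hwv (h w hw)

/-- A proper strong subset with at least two vertices can be replaced by one with one more. -/
theorem StrongOn.exists_strongOn_ncard_succ [Finite V] (hr : IsTourn r) (hS : StrongOn r S)
    (hS' : StrongOn r S') (hsub : S' ⊆ S) (h2 : 2 ≤ S'.ncard) (hneq : S' ≠ S) :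
    ∃ S'' ⊆ S, StrongOn r S'' ∧ S''.ncard = S'.ncard + 1 := by
  have hne : S'.Nonempty := Set.nonempty_of_ncard_ne_zero (by omega)
  obtain ⟨s, hs⟩ := hne
  rcases hS.exists_mixed_or_arc hr hsub ⟨s, hs⟩ hneq with
    ⟨t, ht, ⟨a, ha, hat⟩, b, hb, htb⟩ | ⟨p, hp, q, hq, hSp, hpq, hqS⟩
  · refine ⟨insert t S', Set.insert_subset ht.1 hsub, ?_, Set.ncard_insert_of_notMem ht.2⟩
    intro U hU
    have key : ∀ u ∈ S', u ∈ U → insert t S' ⊆ U := by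
      intro u hu huU
      have h1 : S' ⊆ U := hS' U (fun x hx y hy => hU x (Or.inr hx) y (Or.inr hy)) u hu huU
      exact Set.insert_subset (hU a (Or.inr ha) t (Or.inl rfl) (h1 ha) hat) h1
    rintro u (rfl | hu) huU
    · exact key b hb (hU u (Or.inl rfl) b (Or.inr hb) huU htb)
    · exact key u hu huU
  · have hpq' : p ≠ q := fun e => hr.irrefl p (e ▸ hpq)
    have hcard := Set.ncard_sdiff_singleton_add_one hs
    obtain ⟨w, hw⟩ : (S' \ {s}).Nonempty := Set.nonempty_of_ncard_ne_zero (by omega)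
    -- Two vertices enter, so `s` is dropped to gain exactly one. Strength survives because what is
    -- left is nonempty, dominates `p`, and is dominated by `q`.
    refine ⟨insert p (insert q (S' \ {s})), ?_, ?_, ?_⟩
    · exact Set.insert_subset hp.1 (Set.insert_subset hq.1 (Set.sdiff_subset.trans hsub))
    · intro U hU
      have h1 : p ∈ U → q ∈ U := fun h => hU p (by simp) q (by simp) h hpq
      have h2 : q ∈ U → S' \ {s} ⊆ U := fun h v hv =>
        hU q (by simp) v (by simp [hv.1, hv.2]) h (hqS v hv.1)
      have h3 : ∀ v ∈ S' \ {s}, v ∈ U → p ∈ U := fun v hv h =>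
        hU v (by simp [hv.1, hv.2]) p (by simp) h (hSp v hv.1)
      have key : p ∈ U → insert p (insert q (S' \ {s})) ⊆ U := fun h =>
        Set.insert_subset h (Set.insert_subset (h1 h) (h2 (h1 h)))
      rintro u (rfl | rfl | hu) huU
      · exact key huU
      · exact key (h3 w hw (h2 huU hw))
      · exact key (h3 u hu huU)
    · rw [Set.ncard_insert_of_notMem, Set.ncard_insert_of_notMem]
      · omega
      · exact fun h => hq.2 h.1
      · rintro (h | h)
        · exact hpq' h
        · exact hp.2 h.1

/-- If `x` lay on no 3-cycle, its out-neighbourhood would be closed under out-neighbours, and by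
strength would contain `x`. -/
theorem StrongOn.exists_three_cycle (hr : IsTourn r) (hS : StrongOn r S) (hn : S.Nontrivial) :
    ∃ x ∈ S, ∃ y ∈ S, ∃ z ∈ S, r x y ∧ r y z ∧ r z x := by
  obtain ⟨x, hx, y, hy, hxy⟩ := hn
  obtain ⟨v, hv, -, hxv⟩ := hS.exists_out hx hy hxy.symm
  by_contra hc
  push Not at hc
  refine hr.irrefl x (hS {u | r x u} ?_ v hv hxv hx)
  intro p hp q hq (hxp : r x p) hpq
  by_contra hxq
  have hqx : q ≠ x := by rintro rfl; exact hr.asymm _ _ hpq hxp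
  exact hc x hx p hp q hq hxp hpq ((hr.total q x hqx).resolve_right hxq)

/-- A mixed vertex can be inserted into some arc of a 3-cycle. Otherwise an arc `p q` gives `x → y →
p → q → x`. -/
theorem StrongOn.exists_four_cycle [Finite V] (hr : IsTourn r) (hS : StrongOn r S)
    (hn : 4 ≤ S.ncard) :
    ∃ a ∈ S, ∃ b ∈ S, ∃ c ∈ S, ∃ d ∈ S, r a b ∧ r b c ∧ r c d ∧ r d a := by
  obtain ⟨x, hx, y, hy, z, hz, hxy, hyz, hzx⟩ :=
    hS.exists_three_cycle hr (Set.one_lt_ncard_iff_nontrivial.1 (by omega))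
  have hcard : ({x, y, z} : Set V).ncard ≤ 3 := by
    refine (Set.ncard_insert_le _ _).trans ?_
    have := Set.ncard_insert_le y {z}
    rw [Set.ncard_singleton] at this
    omega
  rcases hS.exists_mixed_or_arc hr (S' := {x, y, z})
    (by rintro _ (rfl | rfl | rfl) <;> assumption) ⟨x, by simp⟩
    (by rintro h; rw [h] at hcard; omega) with
    ⟨t, ht, ⟨a, ha, hat⟩, b, hb, htb⟩ | ⟨p, hp, q, hq, hSp, hpq, hqS⟩
  · have htn : t ≠ x ∧ t ≠ y ∧ t ≠ z := by simpa using ht.2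
    rcases hr.total x t htn.1.symm with h1 | h1 <;> rcases hr.total y t htn.2.1.symm with h2 | h2 <;>
      rcases hr.total z t htn.2.2.symm with h3 | h3
    · exfalso
      rcases hb with rfl | rfl | rfl <;> exact hr.asymm _ _ htb ‹_›
    · exact ⟨y, hy, t, ht.1, z, hz, x, hx, h2, h3, hzx, hxy⟩
    · exact ⟨x, hx, t, ht.1, y, hy, z, hz, h1, h2, hyz, hzx⟩
    · exact ⟨x, hx, t, ht.1, y, hy, z, hz, h1, h2, hyz, hzx⟩
    · exact ⟨z, hz, t, ht.1, x, hx, y, hy, h3, h1, hxy, hyz⟩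
    · exact ⟨y, hy, t, ht.1, z, hz, x, hx, h2, h3, hzx, hxy⟩
    · exact ⟨z, hz, t, ht.1, x, hx, y, hy, h3, h1, hxy, hyz⟩
    · exfalso
      rcases ha with rfl | rfl | rfl <;> exact hr.asymm _ _ hat ‹_›
  · exact ⟨x, hx, y, hy, p, hp.1, q, hq.1, hxy, hSp y (by simp), hpq, hqS x (by simp)⟩

theorem StrongOn.exists_strongOn_ncard [Finite V] (hr : IsTourn r) (hS : StrongOn r S)
    {m : ℕ} (h4 : 4 ≤ m) (hm : m ≤ S.ncard) : ∃ S' ⊆ S, StrongOn r S' ∧ S'.ncard = m := by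
  induction m, h4 using Nat.le_induction with
  | base =>
    obtain ⟨x, hx, y, hy, z, hz, hxy, hyz, hzx⟩ :=
      hS.exists_three_cycle hr (Set.one_lt_ncard_iff_nontrivial.1 (by omega))
    have h : ∀ p q, r p q → p ≠ q := fun p q h e => hr.irrefl p (e ▸ h)
    have hc : ({x, y, z} : Set V).ncard = 3 :=
      Set.ncard_eq_three.2 ⟨x, y, z, h _ _ hxy, (h _ _ hzx).symm, h _ _ hyz, rfl⟩
    have hst : StrongOn r {x, y, z} := by
      intro U hU
      have h1 : x ∈ U → y ∈ U := fun h => hU x (by simp) y (by simp) h hxy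
      have h2 : y ∈ U → z ∈ U := fun h => hU y (by simp) z (by simp) h hyz
      have h3 : z ∈ U → x ∈ U := fun h => hU z (by simp) x (by simp) h hzx
      rintro u (rfl | rfl | rfl) hu v (rfl | rfl | rfl) <;> tauto
    have := hS.exists_strongOn_ncard_succ hr hst
      (by rintro _ (rfl | rfl | rfl) <;> assumption) (by omega)
      (by rintro e; rw [e] at hc; omega)
    rwa [hc] at this
  | succ m h4 ih =>
    obtain ⟨S', hsub, hst, hc⟩ := ih (by omega)
    obtain ⟨S'', h⟩ := hS.exists_strongOn_ncard_succ hr hst hsub (by omega)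
      (by rintro rfl; omega)
    exact ⟨S'', by rwa [hc] at h⟩

theorem ncard_four_cycle (hr : IsTourn r) {a b c d : V} (hab : r a b) (hbc : r b c) (hcd : r c d)
    (hda : r d a) : (({a, c} : Set V) ∪ {b, d}).ncard = 4 := by
  have h := StrongBip.of_four_cycle hr hab hbc hcd hda
  rw [Set.ncard_union_eq h.disj, Set.ncard_pair, Set.ncard_pair]
  · rintro rfl; exact hr.asymm _ _ hbc hcd
  · rintro rfl; exact hr.asymm _ _ hab hbc

/-! ### Order five and the induction -/

/-- The strong tournaments on five vertices. -/
theorem spanned_or_tournamentFive (hr : IsTourn r) (hS : StrongOn r S) {A B : Set V}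
    {a b c d v : V} (hab : r a b) (hbc : r b c) (hcd : r c d) (hda : r d a)
    (hA : A = {a, c}) (hB : B = {b, d}) (hv : v ∉ A ∪ B) (e : S = A ∪ B ∪ {v}) :
    Spanned r S ∨ ∃ f : Fin 5 → V, Set.range f = S ∧
      ∀ i j, Digraph.tournamentFive.Adj i j → r (f i) (f j) := by
  -- Up to rotating the 4-cycle, `v` dominates `{a, c}` and the chord is `a → c`.
  have aux : ∀ A B : Set V, ∀ a b c d, r a b → r b c → r c d → r d a → r a c → A = {a, c} →
      B = {b, d} → v ∉ A ∪ B → S = A ∪ B ∪ {v} → Splits r A B v →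
      Spanned r S ∨ ∃ f : Fin 5 → V, Set.range f = S ∧
        ∀ i j, Digraph.tournamentFive.Adj i j → r (f i) (f j) := by
    rintro _ _ a b c d hab hbc hcd hda hac rfl rfl hv e ⟨h1, h2⟩
    simp only [Set.mem_insert_iff, Set.mem_singleton_iff, forall_eq_or_imp, forall_eq,
      Set.mem_union, not_or] at h1 h2 hv
    have hbd : b ≠ d := by rintro rfl; exact hr.asymm _ _ hab hda
    rcases hr.total b d hbd with hbd | hdb
    · left
      have hne : ∀ p q, r p q → p ≠ q := fun p q h e => hr.irrefl p (e ▸ h)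
      -- The 4-cycle `a → c → d → v → a`, with `b` inserted through `a → b → d`.
      refine ⟨_, _, (StrongBip.of_four_cycle hr hac hcd h2.2 h1.1).symm.extend_one (x := b) ?_
        ⟨⟨a, by simp, hab⟩, d, by simp, hbd⟩, ?_⟩
      · simp [hne _ _ hbd, (hne _ _ hab).symm]
      · rw [e]; ext; simp; clear * -; tauto
    · right
      -- The 3-cycle is `v a b`. It dominates `c` and is dominated by `d`, and `c → d`.
      refine ⟨![v, a, b, c, d], ?_, ?_⟩
      · rw [e]; ext w
        simp [eq_comm]
        clear * -; tauto
      · intro i j hij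
        simp only [Digraph.tournamentFive, Set.mem_insert_iff, Set.mem_singleton_iff,
          Prod.mk.injEq] at hij
        rcases hij with h | h | h | h | h | h | h | h | h | h <;> obtain ⟨rfl, rfl⟩ := h
        exacts [h1.1, hab, h2.1, hcd, h1.2, hac, hbc, h2.2, hda, hdb]
  by_cases hno : Spanned r S
  · exact Or.inl hno
  have h : StrongBip r A B := by
    rw [hA, hB]; exact StrongBip.of_four_cycle hr hab hbc hcd hda
  have hac : a ≠ c := by rintro rfl; exact hr.asymm _ _ hab hbc
  have hbd : b ≠ d := by rintro rfl; exact hr.asymm _ _ hab hda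
  have hA' := hA.trans (Set.pair_comm _ _)
  have hB' := hB.trans (Set.pair_comm _ _)
  rcases h.splits_of_add_one hr hS hv e hno with h1 | h1
  · rcases hr.total a c hac with h2 | h2
    · exact aux A B a b c d hab hbc hcd hda h2 hA hB hv e h1
    · exact aux A B c d a b hcd hda hab hbc h2 hA' hB' hv e h1
  · rw [Set.union_comm A B] at hv e
    rcases hr.total b d hbd with h2 | h2
    · exact aux B A b c d a hbc hcd hda hab h2 hB hA' hv e h1
    · exact aux B A d a b c hda hab hbc hcd h2 hB' hA hv e h1

theorem StrongOn.spanned_of_six_le [Finite V] (hr : IsTourn r) (hS : StrongOn r S)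
    (hn : 6 ≤ S.ncard) : Spanned r S := by
  induction hm : S.ncard using Nat.strong_induction_on generalizing S with
  | _ m ih =>
    -- From 8 on, `m - 2` is at least 6, out of reach of the five-vertex exception.
    obtain h8 | h8 := le_or_gt 8 m
    · obtain ⟨S', hsub, hst, hc⟩ := hS.exists_strongOn_ncard hr (m := m - 2) (by omega) (by omega)
      obtain ⟨A, B, h, rfl⟩ := ih (m - 2) (by omega) hst (by omega) hc
      have h2 : (S \ (A ∪ B)).ncard = 2 := by rw [Set.ncard_sdiff hsub]; omega
      obtain ⟨x, y, hxy, e⟩ := Set.ncard_eq_two.1 h2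
      have hx : x ∈ S \ (A ∪ B) := by simp [e]
      have hy : y ∈ S \ (A ∪ B) := by simp [e]
      exact h.spanned_add_two hr hS hx.2 hy.2 hxy (by rw [← e, Set.union_sdiff_cancel hsub])
    · obtain ⟨a, ha, b, hb, c, hc, d, hd, hab, hbc, hcd, hda⟩ :=
        hS.exists_four_cycle hr (by omega)
      have h4 := ncard_four_cycle hr hab hbc hcd hda
      have h := StrongBip.of_four_cycle hr hab hbc hcd hda
      have hsub : ({a, c} : Set V) ∪ {b, d} ⊆ S := by
        rintro _ ((rfl | rfl) | (rfl | rfl)) <;> assumption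
      have hd := Set.ncard_sdiff hsub
      obtain h6 | h7 : m = 6 ∨ m = 7 := by omega
      · obtain ⟨x, y, hxy, e⟩ := Set.ncard_eq_two.1 (show _ = 2 by rw [hd]; omega)
        have hx : x ∈ S \ ({a, c} ∪ {b, d}) := by rw [e]; simp
        have hy : y ∈ S \ ({a, c} ∪ {b, d}) := by rw [e]; simp
        exact h.spanned_add_two hr hS hx.2 hy.2 hxy (by rw [← e, Set.union_sdiff_cancel hsub])
      · obtain ⟨x, y, z, hxy, hxz, hyz, e⟩ :=
          Set.ncard_eq_three.1 (show _ = 3 by rw [hd]; omega)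
        have hx : x ∈ S \ ({a, c} ∪ {b, d}) := by rw [e]; simp
        have hy : y ∈ S \ ({a, c} ∪ {b, d}) := by rw [e]; simp
        have hz : z ∈ S \ ({a, c} ∪ {b, d}) := by rw [e]; simp
        exact spanned_of_four_cycle_add_three hr hS hab hbc hcd hda rfl rfl hx.2 hy.2 hz.2
          hxy hxz hyz (by rw [← e, Set.union_sdiff_cancel hsub])

/-! ### Return to digraphs -/

/-- Any two distinct vertices of `D` are joined, so irreflexivity of `T` makes `f` injective and
asymmetry makes it reflect arcs. -/
theorem isIsomorphic_of_map (T : Digraph V) (hr : IsTourn T.Adj) {n : ℕ} (D : Digraph (Fin n))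
    (hD : ∀ i j, i ≠ j → D.Adj i j ∨ D.Adj j i) (f : Fin n → V) (hf : Set.range f = Set.univ)
    (h : ∀ i j, D.Adj i j → T.Adj (f i) (f j)) : T.IsIsomorphic D := by
  have hinj : Function.Injective f := by
    intro i j hij
    by_contra hne
    rcases hD i j hne with h1 | h1
    · exact hr.irrefl (f j) (hij ▸ h i j h1)
    · exact hr.irrefl (f j) (by simpa [hij] using h j i h1)
  refine ⟨RelIso.symm ⟨Equiv.ofBijective f ⟨hinj, Set.range_eq_univ.1 hf⟩, ?_⟩⟩
  intro i j
  refine ⟨fun hij => ?_, h i j⟩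
  have hne : i ≠ j := by rintro rfl; exact hr.irrefl _ hij
  exact (hD i j hne).resolve_right fun h1 => hr.asymm _ _ hij (h j i h1)

/-- The bipartite tournament formed by the arcs between the two parts. -/
theorem Spanned.exists_bipartiteTournament [Finite V] (T : Digraph V) (hr : IsTourn T.Adj)
    (h : Spanned T.Adj Set.univ) :
    ∃ H : Digraph V, H ≤ T ∧ H.IsBipartiteTournament ∧ H.IsStrong := by
  classical
  obtain ⟨A, B, h, e⟩ := h
  have hB : B = Aᶜ := (IsCompl.compl_eq ⟨h.disj, codisjoint_iff.2 e⟩).symm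
  refine ⟨⟨Cross T.Adj A B⟩, fun u v huv => huv.1, ⟨⟨fun v hv => hr.irrefl v hv.1, ?_⟩,
    fun u v huv hvu => hr.asymm _ _ huv.1 hvu.1⟩, ?_⟩
  · have := h.left.to_subtype
    have := h.right.to_subtype
    have hs : ∀ p q, (Digraph.toSimpleGraphInclusive ⟨Cross T.Adj A B⟩).Adj p q ↔
        (p ∈ A ∧ q ∉ A ∨ p ∉ A ∧ q ∈ A) := by
      intro p q
      simp only [Digraph.toSimpleGraphInclusive, SimpleGraph.fromRel_adj, Cross, hB,
        Set.mem_compl_iff]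
      refine ⟨fun hpq => by tauto, fun hpq => ?_⟩
      have hne : p ≠ q := by rintro rfl; tauto
      have := hr.total p q hne
      tauto
    refine ⟨Nat.card A, Nat.card B, Nat.card_pos, Nat.card_pos, ⟨?_⟩⟩
    refine RelIso.trans (RelIso.symm ⟨Equiv.Set.sumCompl A, ?_⟩)
      (SimpleGraph.completeBipartiteGraphCongr (Finite.equivFin A)
        ((Equiv.setCongr hB.symm).trans (Finite.equivFin B)))
    rintro (⟨p, hp⟩ | ⟨p, hp⟩) (⟨q, hq⟩ | ⟨q, hq⟩) <;>
      simp [hs] <;> grind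
  · intro u v
    exact h.strong {v | Relation.ReflTransGen (Cross T.Adj A B) u v}
      (fun p _ q _ hup hpq => hup.tail hpq) u (by simp [e]) Relation.ReflTransGen.refl
      (by simp [e])

end Tournament

theorem theorem4p4 {V : Type*} [Finite V] [Nontrivial V] (T : Digraph V)
    (hT : T.IsTournament) (hstrong : T.IsStrong)
    (hC : ¬ T.IsIsomorphic Digraph.cycleThree)
    (hT5 : ¬ T.IsIsomorphic Digraph.tournamentFive) :
    ∃ H : Digraph V, H ≤ T ∧ H.IsBipartiteTournament ∧ H.IsStrong := by
  have hr : Tournament.IsTourn T.Adj := by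
    refine ⟨fun u v h => (hT.2 u v h).or, fun u v h1 h2 => ?_⟩
    by_cases e : u = v
    · exact hT.1 v (e ▸ h1)
    · rcases hT.2 u v e with h | h
      · exact h.2 h2
      · exact h.2 h1
  have hS : Tournament.StrongOn T.Adj Set.univ := by
    intro U hU u _ hu v _
    have huv := hstrong u v
    clear * - hU hu huv
    induction huv with
    | refl => exact hu
    | tail _ hpq ih => exact hU _ trivial _ trivial ih hpq
  refine Tournament.Spanned.exists_bipartiteTournament T hr ?_
  obtain h3 | h4 := Nat.lt_or_ge (Set.univ : Set V).ncard 4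
  -- With fewer than four vertices, a 3-cycle is already the whole tournament.
  · exfalso
    obtain ⟨x, -, y, -, z, -, hxy, hyz, hzx⟩ := hS.exists_three_cycle hr Set.nontrivial_univ
    have hne : ∀ p q, T.Adj p q → p ≠ q := fun p q h e => hr.irrefl p (e ▸ h)
    have hc : ({x, y, z} : Set V).ncard = 3 :=
      Set.ncard_eq_three.2 ⟨x, y, z, hne _ _ hxy, (hne _ _ hzx).symm, hne _ _ hyz, rfl⟩
    have he : ({x, y, z} : Set V) = Set.univ :=
      Set.eq_of_subset_of_ncard_le (Set.subset_univ _) (by omega)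
    refine hC (Tournament.isIsomorphic_of_map T hr _ ?_ ![x, y, z] ?_ ?_)
    · intro i j
      fin_cases i <;> fin_cases j <;> simp [Digraph.cycleThree]
    · rw [← he]; ext w
      simp only [Matrix.range_cons, Matrix.range_empty, Set.union_empty, Set.mem_union,
        Set.mem_singleton_iff, Set.mem_insert_iff]
    · intro i j hij
      simp only [Digraph.cycleThree, Set.mem_insert_iff, Set.mem_singleton_iff,
        Prod.mk.injEq] at hij
      rcases hij with h | h | h <;> obtain ⟨rfl, rfl⟩ := h
      exacts [hxy, hyz, hzx]
  obtain h6 | h6 := le_or_gt 6 (Set.univ : Set V).ncard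
  · exact hS.spanned_of_six_le hr h6
  obtain ⟨a, -, b, -, c, -, d, -, hab, hbc, hcd, hda⟩ := hS.exists_four_cycle hr h4
  have hc := Tournament.ncard_four_cycle hr hab hbc hcd hda
  have hd := Set.ncard_sdiff (Set.subset_univ (({a, c} : Set V) ∪ {b, d}))
  obtain h4 | h5 : (Set.univ : Set V).ncard = 4 ∨ (Set.univ : Set V).ncard = 5 := by omega
  · exact ⟨_, _, Tournament.StrongBip.of_four_cycle hr hab hbc hcd hda,
      Set.eq_of_subset_of_ncard_le (Set.subset_univ _) (by omega)⟩
  · obtain ⟨v, e⟩ := Set.ncard_eq_one.1 (show _ = 1 by rw [hd]; omega)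
    have hv : v ∈ Set.univ \ (({a, c} : Set V) ∪ {b, d}) := by rw [e]; simp
    refine (Tournament.spanned_or_tournamentFive hr hS hab hbc hcd hda rfl rfl hv.2
      (by rw [← e, Set.union_sdiff_cancel (Set.subset_univ _)])).resolve_right ?_
    rintro ⟨f, hf, h⟩
    refine hT5 (Tournament.isIsomorphic_of_map T hr _ ?_ f hf h)
    intro i j
    fin_cases i <;> fin_cases j <;> simp [Digraph.tournamentFive]
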